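/- \textbf{Lemma ($k$-FAT).} Let $G$ be a finite interval graph with a partial representation $\mathcal R'$, that is, an interval representation by closed real intervals of an induced subgraph of $G$; the interval of a pre-drawn vertex $v$ is written $\langle v\rangle'$, and for a clique $a$ let $P(a)$ be the set of pre-drawn vertices in $a$. Let $T$ be the MPQ-tree of $G$: the PQ-tree whose leaves are the maximal cliques of $G$ and whose equivalent reorderings (permuting the children of P-nodes, reversing Q-nodes) have as frontiers exactly the consecutive orderings of the maximal cliques, with vertices assigned to sections in the usual way. For a node $N$, let $T[N]$ be the subtree below $N$ and $G[N]$ the subgraph of $G$ induced by the vertices in the sections of $T[N]$. \emph{Definition of $k$-FAT obstructions.} The graph $H_1$ consists of an induced path $P_1$ from $x_1$ to $z_1\ne x_1$ and a vertex $y_1$ that is neither on $P_1$ nor adjacent to a vertex of $P_1$. For $k\ge 2$, a graph $H_k$ arises from a graph $H_{k-1}$ by adding two new distinct vertices $x_k,t_k$ joined by an induced path $P_k$ whose vertices are all new; $t_k$ is adjacent to every vertex of $H_{k-1}$ except $x_{k-1}$, while $x_k$ and the inner vertices of $P_k$ are adjacent to no vertex of $H_{k-1}$; and $y_k=z_{k-1}$,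 $z_k=y_{k-1}$. A $k$-FAT obstruction is such a graph $H_k$ together with a partial representation whose pre-drawn vertices are exactly $x_k,y_k,z_k$, their intervals being disjoint with $\langle y_k\rangle'$ between $\langle x_k\rangle'$ and $\langle z_k\rangle'$. A graph with a partial representation \emph{contains} an obstruction if the graph of the obstruction is an induced subgraph of it such that pre-drawn vertices are mapped to pre-drawn vertices and the left-to-right order of the endpoints of their intervals is preserved. \emph{Statement.} Let $Q$ be a Q-node of $T$ with children $T_1,\dots,T_n$, and let $a,b,c$ be maximal cliques that are leaves of $T_\alpha,T_\beta,T_\gamma$, respectively, where $\alpha<\beta<\gamma$. Let $x\in P(a)$, $y\in P(c)$ and $z\in P(b)$ be vertices whose pre-drawn intervals are pairwise disjoint and such that $\langle y\rangle'$ lies between $\langle x\rangle'$ and $\langle z\rangle'$. Then there is a $k\ge 1$ such that $G[Q]$ together with $\mathcal R'[\{x,y,z\}]$ (the partial representation in which only $x,y,z$ are pre-drawn) contains a $k$-FAT obstruction, in which $x,y,z$ play the roles of $x_k,y_k,z_k$. -/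

import Mathlib

universe u

namespace IntervalObstruction

/-! ### Partial interval representations -/

/-- A partial interval representation of a graph `G`: an interval representation, by nonempty closed
real intervals, of the subgraph of `G` induced by the set `dom` of pre-drawn vertices. The values of
`left` and `right` outside `dom` are irrelevant. -/
structure PartialRep {V : Type u} (G : SimpleGraph V) where
  dom : Set V
  left : V → ℝ
  right : V → ℝ
  left_le_right : ∀ v ∈ dom, left v ≤ right v
  adj_iff : ∀ v ∈ dom, ∀ w ∈ dom, v ≠ w →
    (G.Adj v w ↔ (Set.Icc (left v) (right v) ∩ Set.Icc (left w) (right w)).Nonempty)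

namespace PartialRep

variable {V : Type u} {G : SimpleGraph V}

/-- The partial representation in which only the vertices of `S` stay pre-drawn. -/
def restrict (R : PartialRep G) (S : Set V) : PartialRep G where
  dom := R.dom ∩ S
  left := R.left
  right := R.right
  left_le_right v hv := R.left_le_right v hv.1
  adj_iff v hv w hw h := R.adj_iff v hv.1 w hw.1 h

/-- The partial representation of the induced subgraph `G[S]` given by the pre-drawn intervals of
the vertices of `S`. -/
def induce (R : PartialRep G) (S : Set V) : PartialRep (G.induce S) where
  dom := {v | (v : V) ∈ R.dom}
  left v := R.left v
  right v := R.right v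
  left_le_right v hv := R.left_le_right v hv
  adj_iff v hv w hw h := by
    simpa using R.adj_iff v hv w hw (fun e => h (Subtype.ext e))

/-- The intervals of `x`, `y`, `z` are pairwise disjoint and that of `y` lies between the other
two. -/
def Between (R : PartialRep G) (x y z : V) : Prop :=
  (R.right x < R.left y ∧ R.right y < R.left z) ∨ (R.right z < R.left y ∧ R.right y < R.left x)

/-- The set `P(a)` of pre-drawn vertices in a clique `a`. -/
def preDrawn (R : PartialRep G) (a : Set V) : Set V := a ∩ R.dom

/-- `f` exhibits the graph `H` with the partial representation `RH` as contained in `G` and `R`: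
`H` is an induced subgraph of `G` via `f`, pre-drawn vertices go to pre-drawn vertices, and the
endpoints of the pre-drawn intervals have the same left-to-right order. -/
structure IsContainment {W : Type u} {H : SimpleGraph W} (RH : PartialRep H) (R : PartialRep G)
    (f : H ↪g G) : Prop where
  map_dom : ∀ v ∈ RH.dom, f v ∈ R.dom
  left_left : ∀ v ∈ RH.dom, ∀ w ∈ RH.dom, RH.left v ≤ RH.left w ↔ R.left (f v) ≤ R.left (f w)
  left_right : ∀ v ∈ RH.dom, ∀ w ∈ RH.dom, RH.left v ≤ RH.right w ↔ R.left (f v) ≤ R.right (f w)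
  right_left : ∀ v ∈ RH.dom, ∀ w ∈ RH.dom, RH.right v ≤ RH.left w ↔ R.right (f v) ≤ R.left (f w)
  right_right : ∀ v ∈ RH.dom, ∀ w ∈ RH.dom,
    RH.right v ≤ RH.right w ↔ R.right (f v) ≤ R.right (f w)

end PartialRep

/-! ### `k`-FAT obstructions -/

/-- `IsFATGraphOn H k S x y z`: the subgraph of `H` induced by `S` is the graph `H_k` of a `k`-FAT
obstruction with distinguished vertices `x_k = x`, `y_k = y`, `z_k = z`.

* `H_1` consists of an induced path from `x_1` to `z_1` and a vertex `y_1` not adjacent to it.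
* `H_(k+1)` arises from `H_k` by adding vertices `x_(k+1)`, `t_(k+1)` and an induced path between
  them. The vertex `t_(k+1)` is adjacent to all vertices of `H_k` except `x_k`; all other vertices
  of the path, including `x_(k+1)`, are adjacent to no vertex of `H_k`. Moreover
  `y_(k+1) = z_k` and `z_(k+1) = y_k`. -/
inductive IsFATGraphOn {W : Type u} (H : SimpleGraph W) : ℕ → Set W → W → W → W → Prop
  | base {x y z : W} (hxz : x ≠ z) (P : H.Walk x z) (hP : P.IsPath) (hP' : P.IsChordless)
      (hy : ∀ v ∈ P.support, v ≠ y ∧ ¬ H.Adj v y) :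
      IsFATGraphOn H 1 ({y} ∪ {v | v ∈ P.support}) x y z
  | step {k : ℕ} {S : Set W} {x y z : W} (h : IsFATGraphOn H k S x y z) {x' t : W} (hxt : x' ≠ t)
      (P : H.Walk x' t) (hP : P.IsPath) (hP' : P.IsChordless)
      (hS : ∀ v ∈ P.support, v ∉ S)
      (ht : ∀ w ∈ S, H.Adj t w ↔ w ≠ x)
      (hin : ∀ v ∈ P.support, v ≠ t → ∀ w ∈ S, ¬ H.Adj v w) :
      IsFATGraphOn H (k + 1) (S ∪ {v | v ∈ P.support}) x' z y

/-- The graph `H` with the partial representation `RH` is a `k`-FAT obstruction with distinguished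
vertices `x`, `y`, `z`: these are exactly the pre-drawn vertices, and `y` is drawn between `x`
and `z`. -/
structure IsFATObstruction {W : Type u} (k : ℕ) (H : SimpleGraph W) (RH : PartialRep H)
    (x y z : W) : Prop where
  graph : IsFATGraphOn H k Set.univ x y z
  dom_eq : RH.dom = {x, y, z}
  between : RH.Between x y z

/-! ### PQ-trees and MPQ-trees -/

/-- Rooted ordered trees with P-nodes, Q-nodes and labelled leaves. -/
inductive PQTree (A : Type u) : Type u
  | leaf (a : A) : PQTree A
  | pnode (ts : List (PQTree A)) : PQTree A
  | qnode (ts : List (PQTree A)) : PQTree A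

namespace PQTree

/-- `T.Frontier l`: the list `l` is the left-to-right sequence of leaves of some tree that is
equivalent to `T`, that is, obtained from `T` by permuting the children of P-nodes arbitrarily and
reversing the order of the children of Q-nodes. -/
inductive Frontier {A : Type u} : PQTree A → List A → Prop
  | leaf (a : A) : Frontier (.leaf a) [a]
  | pnode {ts ts' : List (PQTree A)} {ls : List (List A)} (hp : ts'.Perm ts)
      (h : List.Forall₂ Frontier ts' ls) : Frontier (.pnode ts) ls.flatten
  | qnode {ts : List (PQTree A)} {ls : List (List A)}
      (h : List.Forall₂ Frontier ts ls) : Frontier (.qnode ts) ls.flatten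
  | qnodeReverse {ts : List (PQTree A)} {ls : List (List A)}
      (h : List.Forall₂ Frontier ts.reverse ls) : Frontier (.qnode ts) ls.flatten

/-- `IsSubtree S T`: the tree `S` is the subtree of `T` below some node of `T`. -/
inductive IsSubtree {A : Type u} (S : PQTree A) : PQTree A → Prop
  | refl : IsSubtree S S
  | pnode {ts : List (PQTree A)} {t : PQTree A} (ht : t ∈ ts) (h : IsSubtree S t) :
      IsSubtree S (.pnode ts)
  | qnode {ts : List (PQTree A)} {t : PQTree A} (ht : t ∈ ts) (h : IsSubtree S t) :
      IsSubtree S (.qnode ts)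

/-- The set of leaf labels of a tree. -/
def leaves {A : Type u} (T : PQTree A) : Set A := {a | IsSubtree (.leaf a) T}

/-- Every P-node has at least two children and every Q-node has at least three children. -/
def Proper {A : Type u} (T : PQTree A) : Prop :=
  (∀ ts, IsSubtree (.pnode ts) T → 2 ≤ ts.length) ∧
  (∀ ts, IsSubtree (.qnode ts) T → 3 ≤ ts.length)

end PQTree

variable {V : Type u}

/-- `s` is an inclusion-maximal clique of `G`. -/
def IsMaxClique (G : SimpleGraph V) (s : Set V) : Prop := Maximal G.IsClique s

/-- `l` is a consecutive ordering of the maximal cliques of `G`: it lists each of them exactly once,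
and for every vertex the cliques containing it appear consecutively. -/
structure IsConsecutiveOrdering (G : SimpleGraph V) (l : List (Set V)) : Prop where
  nodup : l.Nodup
  mem_iff : ∀ s, s ∈ l ↔ IsMaxClique G s
  consecutive : ∀ (v : V) (i j k : Fin l.length), i < j → j < k →
    v ∈ l.get i → v ∈ l.get k → v ∈ l.get j

/-- `T` is the PQ-tree of the interval graph `G`: its leaves are the maximal cliques, and the
frontiers of the trees equivalent to `T` are exactly the consecutive orderings of the maximal
cliques. -/
structure IsPQTreeOf (T : PQTree (Set V)) (G : SimpleGraph V) : Prop where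
  proper : T.Proper
  frontier_iff : ∀ l, T.Frontier l ↔ IsConsecutiveOrdering G l

/-- The vertex `v` is contained in no maximal clique of `G` outside the subtree `N`. -/
def OnlyBelow (G : SimpleGraph V) (N : PQTree (Set V)) (v : V) : Prop :=
  ∀ s, IsMaxClique G s → v ∈ s → s ∈ N.leaves

/-- The `i`-th section `s_i(Q)` of a Q-node with subtrees `ts`: the vertices contained only in
maximal cliques of the Q-node, in cliques of at least two of its subtrees, and in some clique of the
`i`-th subtree. -/
def qSection (G : SimpleGraph V) (ts : List (PQTree (Set V))) (i : Fin ts.length) : Set V :=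
  {v | OnlyBelow G (.qnode ts) v ∧ (∃ s ∈ (ts.get i).leaves, v ∈ s) ∧
    ∃ j, j ≠ i ∧ ∃ s ∈ (ts.get j).leaves, v ∈ s}

/-- The union of the sections which the MPQ-tree assigns to the root node of the subtree `N`. For a
leaf or a P-node, the only section consists of the vertices contained in all maximal cliques below
the node and in no other maximal clique. -/
def nodeSections (G : SimpleGraph V) : PQTree (Set V) → Set V
  | .leaf a => {v | v ∈ a ∧ OnlyBelow G (.leaf a) v}
  | .pnode ts => {v | (∀ s ∈ (PQTree.pnode ts).leaves, v ∈ s) ∧ OnlyBelow G (.pnode ts) v}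
  | .qnode ts => ⋃ i, qSection G ts i

/-- The vertices in the sections of all nodes of the subtree `T[N]`; they induce the graph
`G[N]`. -/
def subtreeVerts (G : SimpleGraph V) (N : PQTree (Set V)) : Set V :=
  {v | ∃ M, PQTree.IsSubtree M N ∧ v ∈ nodeSections G M}

end IntervalObstruction

/-!
A consecutive ordering of the maximal cliques turns every vertex into an interval of positions, and
the leaves below the Q-node occupy a contiguous range of positions, in which `x`, `z`, `y` appear in
this order. A vertex that occurs both inside and outside this range occurs in all of it
(`mem_of_mem_outside`), since the part of the ordering below any node may be reversed on its own.

The Q-node enters through one consequence (`exists_isWindow`): inside its range there is no smaller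
range of positions that contains the intervals of `y` and `z`, avoids the clique `a`, and is crossed
only by intervals covering it. Such a range could be reversed (`isConsecutiveOrdering_reflect`),
which would put `c` between `a` and `b`, whereas the children of a Q-node appear in every frontier
in their order or in the reverse order (`IsSubtree.triple_sublist_frontier`).

From there the argument is about intervals only (`IsWindow.exists_isFATGraphOn`). If `x` and `z` are
joined by a path that avoids the closed neighbourhood of `y`, a shortest such path is a 1-FAT graph.
Otherwise let `C` be the component of `x` outside the closed neighbourhood of `y`. It ends before
`z`, and its outer neighbours all extend from `C` to `y`, hence over `z`. They do not all reach the
end of the range, because otherwise the positions after `C` could be reversed. The neighbour `t`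
that ends first, together with a shortest path from `x` to `t` through `C`, is the last layer of the
obstruction. The vertex `t` is adjacent to all intervals that meet the positions between the end of
`C` and its own end, and not to a vertex `x'` that starts directly after `t`. Among these vertices,
read from right to left, `x'`, `y`, `z` again appear in this order, and the same argument yields the
graph of a `(k-1)`-FAT obstruction for `x'`, `z`, `y`. The range of positions shrinks, so the
recursion ends.
-/

namespace IntervalObstruction

/-! ### Chordless paths -/

/-- A shortest walk inside `S` is a chordless path. -/
theorem exists_isChordless_path {W : Type u} {G : SimpleGraph W} {S : Set W} {u v : W}
    (p : G.Walk u v) (hp : ∀ w ∈ p.support, w ∈ S) :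
    ∃ q : G.Walk u v, q.IsPath ∧ q.IsChordless ∧ ∀ w ∈ q.support, w ∈ S := by
  classical
  have hex : ∃ n, ∃ q : G.Walk u v, (∀ w ∈ q.support, w ∈ S) ∧ q.length = n := ⟨_, p, hp, rfl⟩
  obtain ⟨q₀, hq₀, hlen⟩ := Nat.find_spec hex
  have hmin : ∀ q : G.Walk u v, (∀ w ∈ q.support, w ∈ S) → q₀.bypass.length ≤ q.length :=
    fun q hq => (q₀.length_bypass_le_length.trans hlen.le).trans (Nat.find_min' hex ⟨q, hq, rfl⟩)
  have hsupp : ∀ w ∈ q₀.bypass.support, w ∈ S := fun w hw =>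
    hq₀ w (q₀.support_bypass_subset_support hw)
  refine ⟨q₀.bypass, q₀.bypass_isPath, ?_, hsupp⟩
  generalize q₀.bypass = q at hmin hsupp
  -- A chord between positions `i < j` would give a walk that skips what lies between them.
  have key : ∀ i j, i < j → j ≤ q.length → G.Adj (q.getVert i) (q.getVert j) →
      s(q.getVert i, q.getVert j) ∈ q.edges := by
    intro i j hij hj hadj
    have h := hmin ((q.take i).append (.cons hadj (q.drop j))) (by
      intro w hw
      rw [SimpleGraph.Walk.mem_support_append_iff, SimpleGraph.Walk.support_cons,
        List.mem_cons] at hw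
      rcases hw with hw | rfl | hw
      · exact hsupp w ((q.isSubwalk_take i).support_subset hw)
      · exact hsupp _ (q.getVert_mem_support i)
      · exact hsupp w ((q.isSubwalk_drop j).support_subset hw))
    rw [SimpleGraph.Walk.length_append, SimpleGraph.Walk.length_cons,
      SimpleGraph.Walk.take_length, SimpleGraph.Walk.drop_length] at h
    obtain rfl : j = i + 1 := by omega
    exact q.adj_toSubgraph_iff_mem_edges.1 (q.toSubgraph_adj_getVert (by omega))
  rw [SimpleGraph.Walk.isChordless_iff_forall_mem_edges]
  intro a b ha hb hab
  obtain ⟨i, rfl, hi⟩ := SimpleGraph.Walk.mem_support_iff_exists_getVert.1 ha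
  obtain ⟨j, rfl, hj⟩ := SimpleGraph.Walk.mem_support_iff_exists_getVert.1 hb
  rcases lt_trichotomy i j with h | rfl | h
  · exact key i j h hj hab
  · exact (hab.ne rfl).elim
  · rw [Sym2.eq_swap]
    exact key j i h hi hab.symm

/-- Reachability through `B` is realized by a walk all of whose vertices are reachable through
`B`. -/
theorem exists_walk_of_reflTransGen {W : Type u} {G : SimpleGraph W} {B : Set W} {u v : W}
    (h : Relation.ReflTransGen (fun a b => G.Adj a b ∧ b ∈ B) u v) :
    ∃ p : G.Walk u v, ∀ w ∈ p.support,
      Relation.ReflTransGen (fun a b => G.Adj a b ∧ b ∈ B) u w := by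
  induction h with
  | refl => exact ⟨.nil, by simpa using Relation.ReflTransGen.refl⟩
  | tail hab hbc ih =>
    obtain ⟨p, hp⟩ := ih
    refine ⟨p.concat hbc.1, fun w hw => ?_⟩
    rw [SimpleGraph.Walk.support_concat, List.mem_append, List.mem_singleton] at hw
    rcases hw with hw | rfl
    · exact hp w hw
    · exact hab.tail hbc

theorem map_val_support_induce {W : Type u} {G : SimpleGraph W} {U : Set W} {u v : W}
    {p : G.Walk u v} (hU : ∀ w ∈ p.support, w ∈ U) :
    (p.induce U hU).support.map Subtype.val = p.support :=
  (SimpleGraph.Walk.support_map _ _).symm.trans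
    (congrArg SimpleGraph.Walk.support (p.map_induce hU))

theorem mem_support_induce {W : Type u} {G : SimpleGraph W} {U : Set W} {u v : W}
    {p : G.Walk u v} (hU : ∀ w ∈ p.support, w ∈ U) (w : U) :
    w ∈ (p.induce U hU).support ↔ (w : W) ∈ p.support := by
  simp

theorem isChordless_induce {W : Type u} {G : SimpleGraph W} {U : Set W} {u v : W}
    {p : G.Walk u v} (hp : p.IsChordless) (hU : ∀ w ∈ p.support, w ∈ U) :
    (p.induce U hU).IsChordless := by
  rw [SimpleGraph.Walk.isChordless_iff_forall_mem_edges]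
  have hm : (p.induce U hU).edges.map (Sym2.map Subtype.val) = p.edges :=
    (SimpleGraph.Walk.edges_map _ _).symm.trans
      (congrArg SimpleGraph.Walk.edges (p.map_induce hU))
  intro a b ha hb hab
  have he := hp.mem_edges ((mem_support_induce hU a).1 ha) ((mem_support_induce hU b).1 hb) hab
  rw [← hm] at he
  exact (List.mem_map_of_injective (Sym2.map.injective Subtype.val_injective)
    (a := s(a, b))).1 he

theorem isPath_induce {W : Type u} {G : SimpleGraph W} {U : Set W} {u v : W}
    {p : G.Walk u v} (hp : p.IsPath) (hU : ∀ w ∈ p.support, w ∈ U) :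
    (p.induce U hU).IsPath := by
  rw [SimpleGraph.Walk.isPath_def, ← map_val_support_induce hU] at hp
  exact (SimpleGraph.Walk.isPath_def _).2 hp.of_map

/-! ### Graphs of `k`-FAT obstructions -/

theorem IsFATGraphOn.mem {W : Type u} {G : SimpleGraph W} {k : ℕ} {S : Set W} {x y z : W}
    (h : IsFATGraphOn G k S x y z) : x ∈ S ∧ y ∈ S ∧ z ∈ S := by
  induction h with
  | base hxz P hP hP' hy => exact ⟨.inr P.start_mem_support, .inl rfl, .inr P.end_mem_support⟩
  | step h hxt P hP hP' hS ht hin ih =>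
    exact ⟨.inr P.start_mem_support, .inl ih.2.2, .inl ih.2.1⟩

theorem IsFATGraphOn.induce {W : Type u} {G : SimpleGraph W} {k : ℕ} {S : Set W} {x y z : W}
    (h : IsFATGraphOn G k S x y z) {U : Set W} (hSU : S ⊆ U) :
    IsFATGraphOn (G.induce U) k (Subtype.val ⁻¹' S) ⟨x, hSU h.mem.1⟩ ⟨y, hSU h.mem.2.1⟩
      ⟨z, hSU h.mem.2.2⟩ := by
  induction h with
  | @base x y z hxz P hP hP' hy =>
    have hU : ∀ w ∈ P.support, w ∈ U := fun w hw => hSU (.inr hw)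
    convert IsFATGraphOn.base (H := G.induce U) (y := ⟨y, hSU (.inl rfl)⟩)
      (fun e => hxz (congrArg Subtype.val e))
      (P.induce U hU) (isPath_induce hP hU) (isChordless_induce hP' hU) ?_ using 1
    · ext w
      simp [Subtype.ext_iff]
    · intro v hv
      have := hy v ((mem_support_induce hU v).1 hv)
      exact ⟨fun e => this.1 (congrArg Subtype.val e), this.2⟩
  | @step k S x y z h x' t hxt P hP hP' hS ht hin ih =>
    have hU : ∀ w ∈ P.support, w ∈ U := fun w hw => hSU (.inr hw)
    convert IsFATGraphOn.step (H := G.induce U) (ih (fun w hw => hSU (.inl hw)))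
      (fun e => hxt (congrArg Subtype.val e))
      (P.induce U hU) (isPath_induce hP hU) (isChordless_induce hP' hU) ?_ ?_ ?_ using 1
    · ext w
      simp
    · exact fun v hv => hS v ((mem_support_induce hU v).1 hv)
    · intro w hw
      simpa [Subtype.ext_iff] using ht w hw
    · intro v hv hvt w hw
      exact hin v ((mem_support_induce hU v).1 hv) (fun e => hvt (Subtype.ext e)) w hw

/-! ### The search for an obstruction in an interval model -/

/-- Vertices are intervals `[ℓ v, r v]` of integer positions. The window `[L, E]` is the range of
positions, and `A` the set of vertices, in which the graph of an obstruction is sought. The vertex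
`x` ends directly before the window, and `z` lies before `y`; the vertices outside `A` cover the
window if they meet it. `starts` and `ends` express that the sets of vertices at two consecutive
positions are maximal cliques, neither of which contains the other. `no_module` says that inside the
window, no range of positions that contains the intervals of `y` and `z` can be reversed: some
interval crosses its boundary without covering it. -/
structure IsWindow {V : Type u} (G : SimpleGraph V) (ℓ r : V → ℤ) (A : Set V) (L E : ℤ)
    (x y z : V) : Prop where
  le : ∀ v, ℓ v ≤ r v
  adj : ∀ u v, u ≠ v → (G.Adj u v ↔ ℓ u ≤ r v ∧ ℓ v ≤ r u)
  starts : ∀ p, L ≤ p → p < E → ∃ v, ℓ v = p + 1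
  ends : ∀ p, L ≤ p → p < E → ∃ v, r v = p
  no_module : ∀ i j, L ≤ i → j ≤ E → i ≤ ℓ z → i ≤ ℓ y → r z ≤ j → r y ≤ j →
    ¬ ∀ v, ℓ v ≤ j → i ≤ r v → (i ≤ ℓ v ∧ r v ≤ j) ∨ (ℓ v ≤ i ∧ j ≤ r v)
  x_mem : x ∈ A
  y_mem : y ∈ A
  z_mem : z ∈ A
  cover : ∀ v, v ∉ A → ℓ v ≤ E → L ≤ r v → ℓ v ≤ L ∧ E ≤ r v
  right_x : r x + 1 = L
  le_right : ∀ v ∈ A, v ≠ x → L ≤ r v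
  right_le : ∀ v ∈ A, r v ≤ E
  le_right_z : L ≤ r z
  right_z_lt : r z < ℓ y

/-- The obstruction is found by recursion on the size of the window. Let `C` be the component of `x`
in `G[A]` minus the closed neighbourhood of `y`. If `C` contains `z`, a path in `C` gives a 1-FAT
graph. Otherwise `C` lies before `z`, and all neighbours of `C` cover the range from `C` to `y`.
Let `i` be the first position after `C`. As `[i, E]` cannot be reversed, some neighbour of `C` ends
before `E`; let `t` be the one that ends first. The vertex `t` is the vertex `t_k` of the
obstruction, and the rest is found in the window `[i, r t]` read from right to left, with a vertex
that starts directly after `t` in the role of `x`. -/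
theorem IsWindow.exists_isFATGraphOn {V : Type u} [Finite V] {G : SimpleGraph V} {ℓ r : V → ℤ}
    {A : Set V} {L E : ℤ} {x y z : V} (h : IsWindow G ℓ r A L E x y z) :
    ∃ k S, 1 ≤ k ∧ S ⊆ A ∧ IsFATGraphOn G k S x y z := by
  generalize hn : (E - L).toNat = n
  induction n using Nat.strong_induction_on generalizing ℓ r A L E x y z with
  | _ n ih =>
  have hle := h.le
  have hLz := h.le_right_z
  have hzy := h.right_z_lt
  have hrx := h.right_x
  have hlx := hle x
  have hlz := hle z
  have hly := hle y
  have hyE := h.right_le y h.y_mem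
  have hxy : x ≠ y := by rintro rfl; omega
  have hxz : x ≠ z := by rintro rfl; omega
  let B : Set V := {v | v ∈ A ∧ v ≠ y ∧ ¬ G.Adj v y}
  let C : Set V := {v | Relation.ReflTransGen (fun a b => G.Adj a b ∧ b ∈ B) x v}
  have hxB : x ∈ B := ⟨h.x_mem, hxy, fun e => by have := (h.adj x y hxy).1 e; omega⟩
  have hzB : z ∈ B := ⟨h.z_mem, by rintro rfl; omega, fun e => by
    have := (h.adj z y (by rintro rfl; omega)).1 e; omega⟩
  have hxC : x ∈ C := Relation.ReflTransGen.refl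
  have hCB : C ⊆ B := fun v hv => by
    rcases Relation.ReflTransGen.cases_tail hv with rfl | ⟨w, _, hw⟩
    · exact hxB
    · exact hw.2
  have hCstep : ∀ v ∈ C, ∀ w ∈ B, G.Adj v w → w ∈ C := fun v hv w hw hvw =>
    Relation.ReflTransGen.tail hv ⟨hvw, hw⟩
  by_cases hzC : z ∈ C
  · obtain ⟨p, hp⟩ := exists_walk_of_reflTransGen hzC
    obtain ⟨q, hq, hq', hqC⟩ := exists_isChordless_path (S := C) p hp
    refine ⟨1, _, le_rfl, ?_, .base (y := y) hxz q hq hq' fun v hv => (hCB (hqC v hv)).2⟩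
    rintro v (rfl | hv)
    · exact h.y_mem
    · exact (hCB (hqC v hv)).1
  have hCz : ∀ v ∈ C, r v < ℓ z := by
    intro v hv
    have hnadj : ∀ w ∈ C, ¬ G.Adj w z := fun w hw e => hzC (hCstep w hw z hzB e)
    have hne : ∀ w ∈ C, w ≠ z := fun w hw e => hzC (e ▸ hw)
    induction hv with
    | refl =>
      have := mt (h.adj x z hxz).2 (hnadj x hxC)
      omega
    | @tail b c hb hbc ihb =>
      have hc : c ∈ C := hCstep b hb c hbc.2 hbc.1
      have h1 := mt (h.adj c z (hne c hc)).2 (hnadj c hc)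
      have h2 := (h.adj b c hbc.1.ne).1 hbc.1
      omega
  obtain ⟨m, hmC, hm⟩ := Set.exists_max_image C r C.toFinite ⟨x, hxC⟩
  obtain ⟨i, hi⟩ : ∃ i, i = r m + 1 := ⟨_, rfl⟩
  have hiC : ∀ v ∈ C, r v < i := fun v hv => by have := hm v hv; omega
  have hLi : L ≤ i := by have := hm x hxC; omega
  have hiz : i ≤ ℓ z := by have := hCz m hmC; omega
  -- The neighbours of `C` in `A` that lie outside `C`; each of them is a neighbour of `y`.
  let N : Set V := {w | w ∈ A ∧ w ∉ C ∧ ∃ v ∈ C, G.Adj v w}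
  have hN : ∀ w ∈ N, ℓ w < i ∧ ℓ y ≤ r w := by
    rintro w ⟨hwA, hwC, v, hv, hvw⟩
    have h1 := (h.adj v w hvw.ne).1 hvw
    have h2 := hiC v hv
    have hwy : w ≠ y := by
      rintro rfl
      exact (hCB hv).2.2 hvw
    have hadj : G.Adj w y := by
      by_contra hcon
      exact hwC (hCstep v hv w ⟨hwA, hwy, hcon⟩ hvw)
    have h3 := (h.adj w y hwy).1 hadj
    omega
  have hcross : ∀ v ∈ A, ℓ v < i → i ≤ r v → v ∈ N := by
    intro v hv h1 h2
    have hvC : v ∉ C := fun hc => by have := hiC v hc; omega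
    have hmv : m ≠ v := by rintro rfl; exact hvC hmC
    have := hle m
    exact ⟨hv, hvC, m, hmC, (h.adj m v hmv).2 (by omega)⟩
  -- If all these neighbours reached `E`, the range `[i, E]` could be reversed.
  obtain ⟨w₀, hw₀, hw₀E⟩ : ∃ w ∈ N, r w < E := by
    by_contra! hcon
    refine h.no_module i E hLi le_rfl hiz (by omega) (by omega) hyE fun v h1 h2 => ?_
    by_cases hvA : v ∈ A
    · by_cases hiv : i ≤ ℓ v
      · exact .inl ⟨hiv, h.right_le v hvA⟩
      · exact .inr ⟨by omega, hcon v (hcross v hvA (by omega) h2)⟩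
    · have := h.cover v hvA h1 (by omega)
      exact .inr ⟨by omega, this.2⟩
  obtain ⟨t, htN, ht⟩ := Set.exists_min_image N r N.toFinite ⟨w₀, hw₀⟩
  have htE : r t < E := by have := ht w₀ hw₀; omega
  have hti := hN t htN
  obtain ⟨x', hx'⟩ := h.starts (r t) (by omega) htE
  have hlx' := hle x'
  have hx'A : x' ∈ A := by
    by_contra hcon
    have := h.cover x' hcon (by omega) (by omega)
    omega
  let A' : Set V := {v | v ∈ A ∧ i ≤ ℓ v ∧ (ℓ v ≤ r t ∨ v = x')}
  -- Reading from right to left negates positions and exchanges `ℓ` and `r`; the intervals of `y`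
  -- and `z` exchange their roles as well.
  have hwin : IsWindow G (fun v => - r v) (fun v => - ℓ v) A' (- r t) (- i) x' z y := by
    refine ⟨fun v => by have := hle v; omega, fun u v huv => ?_, fun p h1 h2 => ?_,
      fun p h1 h2 => ?_, fun j₁ j₂ h1 h2 h3 h4 h5 h6 hmod => ?_, ⟨hx'A, by omega, .inr rfl⟩,
      ⟨h.z_mem, hiz, .inl (by omega)⟩, ⟨h.y_mem, by omega, .inl (by omega)⟩,
      fun v hv h1 h2 => ?_, by omega, fun v hv hne => ?_, fun v hv => ?_, by omega, by omega⟩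
    · rw [h.adj u v huv]
      omega
    · obtain ⟨v, hv⟩ := h.ends (-p - 1) (by omega) (by omega)
      exact ⟨v, by omega⟩
    · obtain ⟨v, hv⟩ := h.starts (-p - 1) (by omega) (by omega)
      exact ⟨v, by omega⟩
    · refine h.no_module (-j₂) (-j₁) (by omega) (by omega) (by omega) (by omega) (by omega)
        (by omega) fun v hv1 hv2 => ?_
      have := hmod v (by omega) (by omega)
      omega
    · by_cases hvA : v ∈ A
      · have hvi : ℓ v < i := by
          by_contra hcon
          exact hv ⟨hvA, by omega, .inl (by omega)⟩
        have := ht v (hcross v hvA hvi (by omega))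
        omega
      · have := h.cover v hvA (by omega) (by omega)
        omega
    · have := hv.2.2.resolve_right hne
      omega
    · have := hv.2.1
      omega
  obtain ⟨k, S, hk, hSA', hS⟩ := ih _ (by omega) hwin rfl
  obtain ⟨htA, htC, v₀, hv₀, hv₀t⟩ := htN
  obtain ⟨p, hp⟩ := exists_walk_of_reflTransGen hv₀
  obtain ⟨q, hq, hq', hqC⟩ := exists_isChordless_path (S := insert t C) (p.concat hv₀t) (by
    intro w hw
    rw [SimpleGraph.Walk.support_concat, List.mem_append, List.mem_singleton] at hw
    rcases hw with hw | rfl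
    · exact .inr (hp w hw)
    · exact .inl rfl)
  refine ⟨k + 1, _, by omega, ?_, .step hS (x' := x) (t := t) (fun e => htC (e ▸ hxC)) q hq hq'
    ?_ ?_ ?_⟩
  · rintro v (hv | hv)
    · exact (hSA' hv).1
    · rcases hqC v hv with rfl | hv
      · exact htA
      · exact (hCB hv).1
  · intro v hv hvS
    have h1 := (hSA' hvS).2.1
    have h2 := hle v
    rcases hqC v hv with rfl | hv
    · omega
    · have := hiC v hv
      omega
  · intro w hw
    obtain ⟨hwA, h1, h2⟩ := hSA' hw
    have htw : t ≠ w := by rintro rfl; omega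
    have := hle w
    rw [h.adj t w htw]
    refine ⟨fun h3 e => by rw [e] at h3; omega, fun hne => ?_⟩
    have := h2.resolve_right hne
    omega
  · intro v hv hvt w hw hvw
    have h1 := (hSA' hw).2.1
    have h2 := hiC v ((hqC v hv).resolve_left hvt)
    have := (h.adj v w hvw.ne).1 hvw
    omega

/-! ### Frontiers of PQ-trees -/

namespace PQTree

/-- Induction on PQ-trees, with the hypothesis for all children of a node. -/
theorem tree_induction {A : Type u} {motive : PQTree A → Prop} (leaf : ∀ a, motive (.leaf a))
    (pnode : ∀ ts, (∀ t ∈ ts, motive t) → motive (.pnode ts))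
    (qnode : ∀ ts, (∀ t ∈ ts, motive t) → motive (.qnode ts)) : ∀ T, motive T
  | .leaf a => leaf a
  | .pnode ts => pnode ts fun t _ => tree_induction leaf pnode qnode t
  | .qnode ts => qnode ts fun t _ => tree_induction leaf pnode qnode t

theorem IsSubtree.trans {A : Type u} {M N T : PQTree A} (hN : IsSubtree N T)
    (hM : IsSubtree M N) : IsSubtree M T := by
  induction hN with
  | refl => exact hM
  | pnode ht _ ih => exact .pnode ht ih
  | qnode ht _ ih => exact .qnode ht ih

theorem mem_leaves_leaf {A : Type u} {a s : A} : s ∈ (PQTree.leaf a).leaves ↔ s = a := by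
  refine ⟨fun h => ?_, ?_⟩
  · cases h
    rfl
  · rintro rfl
    exact .refl

theorem mem_leaves_pnode {A : Type u} {ts : List (PQTree A)} {s : A} :
    s ∈ (PQTree.pnode ts).leaves ↔ ∃ t ∈ ts, s ∈ t.leaves := by
  refine ⟨fun h => ?_, fun ⟨t, ht, h⟩ => .pnode ht h⟩
  cases h with
  | pnode ht h => exact ⟨_, ht, h⟩

theorem mem_leaves_qnode {A : Type u} {ts : List (PQTree A)} {s : A} :
    s ∈ (PQTree.qnode ts).leaves ↔ ∃ t ∈ ts, s ∈ t.leaves := by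
  refine ⟨fun h => ?_, fun ⟨t, ht, h⟩ => .qnode ht h⟩
  cases h with
  | qnode ht h => exact ⟨_, ht, h⟩

theorem exists_forall₂ {α β : Type*} {P : α → β → Prop} {l : List α}
    (h : ∀ a ∈ l, ∃ b, P a b) : ∃ l', List.Forall₂ P l l' := by
  induction l with
  | nil => exact ⟨[], .nil⟩
  | cons a l ih =>
    obtain ⟨b, hb⟩ := h a List.mem_cons_self
    obtain ⟨l', hl'⟩ := ih fun a ha => h a (List.mem_cons_of_mem _ ha)
    exact ⟨b :: l', .cons hb hl'⟩

theorem exists_forall₂_sublist {α β : Type*} {P : α → β → Prop} {l₁ l₂ : List α} {l : List β}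
    (hs : l₁.Sublist l₂) (h : List.Forall₂ P l₂ l) :
    ∃ l', l'.Sublist l ∧ List.Forall₂ P l₁ l' := by
  induction hs generalizing l with
  | slnil => exact ⟨[], List.nil_sublist _, .nil⟩
  | cons a hs ih =>
    cases h with
    | cons hab h =>
      obtain ⟨l', h1, h2⟩ := ih h
      exact ⟨l', h1.cons _, h2⟩
  | cons_cons a hs ih =>
    cases h with
    | cons hab h =>
      obtain ⟨l', h1, h2⟩ := ih h
      exact ⟨_ :: l', h1.cons_cons _, .cons hab h2⟩

theorem pair_sublist_or {α : Type*} {l : List α} {a b : α} (ha : a ∈ l) (hb : b ∈ l)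
    (hab : a ≠ b) : [a, b].Sublist l ∨ [b, a].Sublist l := by
  obtain ⟨p, q, rfl⟩ := List.append_of_mem ha
  rcases List.mem_append.1 hb with hb | hb
  · exact .inr ((List.singleton_sublist.2 hb).append
      (List.singleton_sublist.2 List.mem_cons_self))
  · have := (List.mem_cons.1 hb).resolve_left hab.symm
    exact .inl (((List.singleton_sublist.2 this).cons_cons a).trans
      (List.sublist_append_right p _))

theorem exists_frontier {A : Type u} (T : PQTree A) : ∃ l, T.Frontier l := by
  induction T using tree_induction with
  | leaf a => exact ⟨_, .leaf a⟩
  | pnode ts ih =>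
    obtain ⟨ls, h⟩ := exists_forall₂ ih
    exact ⟨_, .pnode (.refl _) h⟩
  | qnode ts ih =>
    obtain ⟨ls, h⟩ := exists_forall₂ ih
    exact ⟨_, .qnode h⟩

theorem exists_frontiers {A : Type u} (ts : List (PQTree A)) :
    ∃ ls, List.Forall₂ Frontier ts ls :=
  exists_forall₂ fun t _ => t.exists_frontier

theorem forall₂_map_reverse {A : Type u} {ts : List (PQTree A)} {ls : List (List A)}
    (h : List.Forall₂ Frontier ts ls)
    (ih : ∀ t ∈ ts, ∀ l, t.Frontier l → t.Frontier l.reverse) :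
    List.Forall₂ Frontier ts (ls.map List.reverse) := by
  induction h with
  | nil => exact .nil
  | cons hab h ih' =>
    exact .cons (ih _ List.mem_cons_self _ hab)
      (ih' fun t ht => ih t (List.mem_cons_of_mem _ ht))

theorem Frontier.reverse {A : Type u} {T : PQTree A} :
    ∀ {l : List A}, T.Frontier l → T.Frontier l.reverse := by
  induction T using tree_induction with
  | leaf a =>
    intro l h
    cases h
    exact .leaf a
  | pnode ts ih =>
    intro l h
    cases h with
    | @pnode _ ts' ls hp h =>
      rw [List.reverse_flatten]
      exact .pnode ((List.reverse_perm _).trans hp) (List.forall₂_reverse_iff.2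
        (forall₂_map_reverse h fun t ht l => ih t (hp.subset ht)))
  | qnode ts ih =>
    intro l h
    cases h with
    | qnode h =>
      rw [List.reverse_flatten]
      exact .qnodeReverse (List.forall₂_reverse_iff.2
        (forall₂_map_reverse h fun t ht l => ih t ht))
    | qnodeReverse h =>
      rw [List.reverse_flatten]
      refine .qnode ?_
      have := List.forall₂_reverse_iff.2
        (forall₂_map_reverse h fun t ht l => ih t (List.mem_reverse.1 ht))
      rwa [List.reverse_reverse] at this

theorem mem_flatten_iff_of_forall₂ {A : Type u} {ts : List (PQTree A)} {ls : List (List A)}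
    (h : List.Forall₂ Frontier ts ls) {s : A}
    (ih : ∀ t ∈ ts, ∀ l, t.Frontier l → (s ∈ l ↔ s ∈ t.leaves)) :
    s ∈ ls.flatten ↔ ∃ t ∈ ts, s ∈ t.leaves := by
  induction h with
  | nil => simp
  | cons hab h ih' =>
    rw [List.flatten_cons, List.mem_append, List.exists_mem_cons_iff,
      ih _ List.mem_cons_self _ hab, ih' fun t ht => ih t (List.mem_cons_of_mem _ ht)]

theorem Frontier.mem_iff {A : Type u} {T : PQTree A} {s : A} :
    ∀ {l : List A}, T.Frontier l → (s ∈ l ↔ s ∈ T.leaves) := by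
  induction T using tree_induction with
  | leaf a =>
    intro l h
    cases h
    rw [mem_leaves_leaf, List.mem_singleton]
  | pnode ts ih =>
    intro l h
    cases h with
    | pnode hp h =>
      rw [mem_leaves_pnode, mem_flatten_iff_of_forall₂ h fun t ht l => ih t (hp.subset ht)]
      simp only [hp.mem_iff]
  | qnode ts ih =>
    intro l h
    cases h with
    | qnode h =>
      rw [mem_leaves_qnode, mem_flatten_iff_of_forall₂ h fun t ht l => ih t ht]
    | qnodeReverse h =>
      rw [mem_leaves_qnode,
        mem_flatten_iff_of_forall₂ h fun t ht l => ih t (List.mem_reverse.1 ht)]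
      simp only [List.mem_reverse]

theorem exists_forall₂_frontier_of_mem {A : Type u} {ts : List (PQTree A)} {t : PQTree A}
    (ht : t ∈ ts) : ∃ ls₁ ls₂ : List (List A), ∀ l, t.Frontier l →
      List.Forall₂ Frontier ts (ls₁ ++ l :: ls₂) := by
  obtain ⟨p, q, rfl⟩ := List.append_of_mem ht
  obtain ⟨ls₁, h₁⟩ := exists_frontiers p
  obtain ⟨ls₂, h₂⟩ := exists_frontiers q
  exact ⟨ls₁, ls₂, fun l hl => List.rel_append h₁ (.cons hl h₂)⟩

/-- Some frontier of `T` stays one when its part below the node `N` is replaced by another frontier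
of `N`. -/
theorem IsSubtree.exists_frontier_append {A : Type u} {N T : PQTree A} (h : IsSubtree N T) :
    ∃ l₁ l₂ : List A, ∀ l, N.Frontier l → T.Frontier (l₁ ++ l ++ l₂) := by
  induction h with
  | refl => exact ⟨[], [], fun l hl => by simpa using hl⟩
  | pnode ht _ ih =>
    obtain ⟨l₁, l₂, ih⟩ := ih
    obtain ⟨ls₁, ls₂, h⟩ := exists_forall₂_frontier_of_mem ht
    refine ⟨ls₁.flatten ++ l₁, l₂ ++ ls₂.flatten, fun l hl => ?_⟩
    simpa using Frontier.pnode (.refl _) (h _ (ih l hl))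
  | qnode ht _ ih =>
    obtain ⟨l₁, l₂, ih⟩ := ih
    obtain ⟨ls₁, ls₂, h⟩ := exists_forall₂_frontier_of_mem ht
    refine ⟨ls₁.flatten ++ l₁, l₂ ++ ls₂.flatten, fun l hl => ?_⟩
    simpa using Frontier.qnode (h _ (ih l hl))

theorem exists_frontier_sublist_flatten {A : Type u} {ts : List (PQTree A)} {ls : List (List A)}
    (h : List.Forall₂ Frontier ts ls) {t : PQTree A} (ht : t ∈ ts) :
    ∃ l, t.Frontier l ∧ l.Sublist ls.flatten := by
  obtain ⟨l', hl', h'⟩ := exists_forall₂_sublist (List.singleton_sublist.2 ht) h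
  cases h' with
  | cons hl hn =>
    cases hn
    exact ⟨_, hl, by simpa using hl'.flatten⟩

theorem IsSubtree.exists_frontier_sublist {A : Type u} {N T : PQTree A} (h : IsSubtree N T) :
    ∀ {l : List A}, T.Frontier l → ∃ l', N.Frontier l' ∧ l'.Sublist l := by
  induction h with
  | refl => exact fun hl => ⟨_, hl, List.Sublist.refl _⟩
  | pnode ht _ ih =>
    intro l hl
    cases hl with
    | pnode hp h =>
      obtain ⟨l₁, h₁, hs₁⟩ := exists_frontier_sublist_flatten h (hp.mem_iff.2 ht)
      obtain ⟨l₂, h₂, hs₂⟩ := ih h₁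
      exact ⟨l₂, h₂, hs₂.trans hs₁⟩
  | qnode ht _ ih =>
    intro l hl
    cases hl with
    | qnode h =>
      obtain ⟨l₁, h₁, hs₁⟩ := exists_frontier_sublist_flatten h ht
      obtain ⟨l₂, h₂, hs₂⟩ := ih h₁
      exact ⟨l₂, h₂, hs₂.trans hs₁⟩
    | qnodeReverse h =>
      obtain ⟨l₁, h₁, hs₁⟩ := exists_frontier_sublist_flatten h (List.mem_reverse.2 ht)
      obtain ⟨l₂, h₂, hs₂⟩ := ih h₁
      exact ⟨l₂, h₂, hs₂.trans hs₁⟩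

theorem triple_sublist_flatten {A : Type u} {us : List (PQTree A)} {ls : List (List A)}
    (h : List.Forall₂ Frontier us ls) {t₁ t₂ t₃ : PQTree A} (ht : [t₁, t₂, t₃].Sublist us)
    {a b c : A} (ha : a ∈ t₁.leaves) (hb : b ∈ t₂.leaves) (hc : c ∈ t₃.leaves) :
    [a, b, c].Sublist ls.flatten := by
  obtain ⟨l', hl', h'⟩ := exists_forall₂_sublist ht h
  cases h' with
  | cons h1 h' =>
    cases h' with
    | cons h2 h' =>
      cases h' with
      | cons h3 h' =>
        cases h'
        refine List.Sublist.trans ?_ hl'.flatten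
        exact (List.singleton_sublist.2 (h1.mem_iff.2 ha)).append
          ((List.singleton_sublist.2 (h2.mem_iff.2 hb)).append
            ((List.singleton_sublist.2 (h3.mem_iff.2 hc)).append (List.nil_sublist [])))

theorem triple_get_sublist {α : Type*} {ts : List α} {i j k : Fin ts.length} (hij : i < j)
    (hjk : j < k) : [ts.get i, ts.get j, ts.get k].Sublist ts := by
  have h : [i, j, k].Pairwise (· < ·) := by
    simp [hij, hjk, hij.trans hjk]
  simpa using List.map_getElem_sublist h

/-- In every frontier of a tree, the children of a Q-node appear in their order or in the reverse
order. -/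
theorem IsSubtree.triple_sublist_frontier {A : Type u} {ts : List (PQTree A)} {T : PQTree A}
    (hQ : IsSubtree (.qnode ts) T) {i j k : Fin ts.length} (hij : i < j) (hjk : j < k) {a b c : A}
    (ha : a ∈ (ts.get i).leaves) (hb : b ∈ (ts.get j).leaves) (hc : c ∈ (ts.get k).leaves)
    {l : List A} (hl : T.Frontier l) : [a, b, c].Sublist l ∨ [c, b, a].Sublist l := by
  obtain ⟨l', hl', hs⟩ := hQ.exists_frontier_sublist hl
  cases hl' with
  | qnode h =>
    exact .inl ((triple_sublist_flatten h (triple_get_sublist hij hjk) ha hb hc).trans hs)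
  | qnodeReverse h =>
    exact .inr ((triple_sublist_flatten h (triple_get_sublist hij hjk).reverse hc hb ha).trans hs)

end PQTree

/-! ### Vertices below a node of the PQ-tree -/

theorem IsConsecutiveOrdering.mem_of_sublist {V : Type u} {G : SimpleGraph V} {l : List (Set V)}
    (h : IsConsecutiveOrdering G l) {s₁ s₂ s₃ : Set V} (hs : [s₁, s₂, s₃].Sublist l) {v : V}
    (h₁ : v ∈ s₁) (h₃ : v ∈ s₃) : v ∈ s₂ := by
  obtain ⟨f, hf⟩ := List.sublist_iff_exists_fin_orderEmbedding_get_eq.1 hs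
  have e₀ := hf ⟨0, by simp⟩
  have e₁ := hf ⟨1, by simp⟩
  have e₂ := hf ⟨2, by simp⟩
  simp only [List.get_eq_getElem, List.getElem_cons_zero, List.getElem_cons_succ] at e₀ e₁ e₂
  rw [e₁]
  refine h.consecutive v (f ⟨0, by simp⟩) (f ⟨1, by simp⟩) (f ⟨2, by simp⟩)
    (f.lt_iff_lt.2 (by simp)) (f.lt_iff_lt.2 (by simp)) ?_ ?_
  · rw [List.get_eq_getElem, ← e₀]
    exact h₁
  · rw [List.get_eq_getElem, ← e₂]
    exact h₃

/-- A vertex that occurs below the node `N` and also outside `N` occurs in all cliques below `N`: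
otherwise reversing the part below `N` would break the consecutivity. -/
theorem mem_of_mem_outside {V : Type u} {G : SimpleGraph V} {T N : PQTree (Set V)}
    (hT : IsPQTreeOf T G) {l₁ l₂ : List (Set V)}
    (hl : ∀ l, N.Frontier l → T.Frontier (l₁ ++ l ++ l₂)) {v : V} {s s' s'' : Set V}
    (hs : s ∈ l₁ ∨ s ∈ l₂) (hvs : v ∈ s) (hs' : s' ∈ N.leaves) (hvs' : v ∈ s')
    (hs'' : s'' ∈ N.leaves) : v ∈ s'' := by
  obtain ⟨l, hNl⟩ := N.exists_frontier
  rcases eq_or_ne s' s'' with rfl | hne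
  · exact hvs'
  have hfront : ∀ m, N.Frontier m → IsConsecutiveOrdering G (l₁ ++ m ++ l₂) := fun m hm =>
    (hT.frontier_iff _).1 (hl m hm)
  have key : ∃ m₁ m₂, N.Frontier m₁ ∧ N.Frontier m₂ ∧ [s', s''].Sublist m₁ ∧
      [s'', s'].Sublist m₂ := by
    rcases PQTree.pair_sublist_or (hNl.mem_iff.2 hs') (hNl.mem_iff.2 hs'') hne with h | h
    · exact ⟨l, l.reverse, hNl, hNl.reverse, h, h.reverse⟩
    · exact ⟨l.reverse, l, hNl.reverse, hNl, h.reverse, h⟩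
  obtain ⟨m₁, m₂, hm₁, hm₂, hs₁, hs₂⟩ := key
  rcases hs with hs | hs
  · refine (hfront m₂ hm₂).mem_of_sublist (s₁ := s) (s₃ := s') ?_ hvs hvs'
    exact ((List.singleton_sublist.2 hs).append hs₂).trans (List.sublist_append_left _ _)
  · refine (hfront m₁ hm₁).mem_of_sublist (s₁ := s') (s₃ := s) ?_ hvs' hvs
    exact (((hs₁.trans (List.sublist_append_right l₁ _))).append (List.singleton_sublist.2 hs))

/-- A vertex that occurs below two children of a P-node occurs in all cliques below the P-node. -/
theorem mem_of_mem_two_children {V : Type u} {G : SimpleGraph V} {T : PQTree (Set V)}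
    (hT : IsPQTreeOf T G) {ts : List (PQTree (Set V))} (hP : PQTree.IsSubtree (.pnode ts) T)
    {t₁ t₂ : PQTree (Set V)} {us : List (PQTree (Set V))} (hts : (t₁ :: t₂ :: us).Perm ts) {v : V}
    {s₁ s₂ s : Set V} (h₁ : s₁ ∈ t₁.leaves) (hv₁ : v ∈ s₁) (h₂ : s₂ ∈ t₂.leaves) (hv₂ : v ∈ s₂)
    (hs : s ∈ (PQTree.pnode ts).leaves) : v ∈ s := by
  obtain ⟨l₁, l₂, hl⟩ := hP.exists_frontier_append
  have hcons : ∀ ts' ls, ts'.Perm ts → List.Forall₂ PQTree.Frontier ts' ls →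
      ∀ s₁ s₂ s₃ : Set V, [s₁, s₂, s₃].Sublist ls.flatten → v ∈ s₁ → v ∈ s₃ → v ∈ s₂ :=
    fun ts' ls hp h s₁ s₂ s₃ hsub => ((hT.frontier_iff _).1 (hl _ (.pnode hp h))).mem_of_sublist
      ((hsub.trans (List.sublist_append_right _ _)).trans (List.sublist_append_left _ _))
  -- A clique below `t₁` or `t₂` lies between `s₁` and `s₂` if these two children are ordered well.
  have same : ∀ (t₁ t₂ : PQTree (Set V)) (s₁ s₂ : Set V), (t₁ :: t₂ :: us).Perm ts →
      s₁ ∈ t₁.leaves → v ∈ s₁ → s₂ ∈ t₂.leaves → v ∈ s₂ → s ∈ t₁.leaves → v ∈ s := by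
    intro t₁ t₂ s₁ s₂ hts h₁ hv₁ h₂ hv₂ hs
    obtain ⟨f₁, hf₁⟩ := t₁.exists_frontier
    obtain ⟨f₂, hf₂⟩ := t₂.exists_frontier
    obtain ⟨fs, hfs⟩ := PQTree.exists_frontiers us
    rcases eq_or_ne s₁ s with rfl | hne
    · exact hv₁
    have hsub₂ := List.singleton_sublist.2 (hf₂.mem_iff.2 h₂)
    rcases PQTree.pair_sublist_or (hf₁.mem_iff.2 h₁) (hf₁.mem_iff.2 hs) hne with h | h
    · refine hcons _ _ hts (.cons hf₁ (.cons hf₂ hfs)) s₁ s s₂ ?_ hv₁ hv₂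
      exact h.append (hsub₂.trans (List.sublist_append_left _ _))
    · refine hcons _ _ ((List.Perm.swap _ _ _).trans hts) (.cons hf₂ (.cons hf₁ hfs)) s₂ s s₁ ?_
        hv₂ hv₁
      exact hsub₂.append (h.trans (List.sublist_append_left _ _))
  obtain ⟨t, ht, hs⟩ := PQTree.mem_leaves_pnode.1 hs
  rcases List.mem_cons.1 (hts.mem_iff.2 ht) with rfl | ht
  · exact same _ _ _ _ hts h₁ hv₁ h₂ hv₂ hs
  rcases List.mem_cons.1 ht with rfl | ht
  · exact same _ _ _ _ ((List.Perm.swap _ _ _).trans hts) h₂ hv₂ h₁ hv₁ hs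
  obtain ⟨p, q, rfl⟩ := List.append_of_mem ht
  obtain ⟨ls, hls⟩ := PQTree.exists_frontiers (t₁ :: t :: t₂ :: (p ++ q))
  refine hcons _ _ (List.Perm.trans ?_ hts) hls s₁ s s₂
    (PQTree.triple_sublist_flatten hls ?_ h₁ hs h₂) hv₁ hv₂
  · exact .cons _ ((List.Perm.swap _ _ _).trans (.cons _ List.perm_middle.symm))
  · exact (((List.nil_sublist _).cons_cons _).cons_cons _).cons_cons _

/-- The vertices in the sections below `N` include all vertices that occur only in cliques below
`N`. -/
theorem mem_subtreeVerts {V : Type u} {G : SimpleGraph V} {T : PQTree (Set V)}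
    (hT : IsPQTreeOf T G) {v : V} {N : PQTree (Set V)} :
    PQTree.IsSubtree N T → OnlyBelow G N v → (∃ s ∈ N.leaves, v ∈ s) → v ∈ subtreeVerts G N := by
  induction N using PQTree.tree_induction with
  | leaf a =>
    rintro hN hv ⟨s, hs, hvs⟩
    rw [PQTree.mem_leaves_leaf] at hs
    exact ⟨_, .refl, hs ▸ hvs, hv⟩
  | pnode ts ih =>
    rintro hN hv ⟨s, hs, hvs⟩
    obtain ⟨t, ht, hst⟩ := PQTree.mem_leaves_pnode.1 hs
    obtain ⟨p, q, hpq⟩ := List.append_of_mem ht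
    have hperm : (t :: (p ++ q)).Perm ts := hpq ▸ List.perm_middle.symm
    by_cases hex : ∃ t₂ ∈ p ++ q, ∃ s₂ ∈ t₂.leaves, v ∈ s₂
    · obtain ⟨t₂, ht₂, s₂, hs₂, hvs₂⟩ := hex
      obtain ⟨p', q', hpq'⟩ := List.append_of_mem ht₂
      have hperm' : (t :: t₂ :: (p' ++ q')).Perm ts :=
        (List.Perm.cons _ (hpq' ▸ List.perm_middle.symm)).trans hperm
      exact ⟨_, .refl, fun s' => mem_of_mem_two_children hT hN hperm' hst hvs hs₂ hvs₂, hv⟩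
    · obtain ⟨M, hM, hvM⟩ := ih t ht (hN.trans (.pnode ht .refl)) (fun s' hs' hvs' => by
        obtain ⟨t', ht', hst'⟩ := PQTree.mem_leaves_pnode.1 (hv s' hs' hvs')
        rcases List.mem_cons.1 (hperm.mem_iff.2 ht') with rfl | h
        · exact hst'
        · exact (hex ⟨t', h, s', hst', hvs'⟩).elim) ⟨s, hst, hvs⟩
      exact ⟨M, .pnode ht hM, hvM⟩
  | qnode ts ih =>
    rintro hN hv ⟨s, hs, hvs⟩
    obtain ⟨t, ht, hst⟩ := PQTree.mem_leaves_qnode.1 hs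
    obtain ⟨i, rfl⟩ := List.get_of_mem ht
    by_cases hex : ∃ j, j ≠ i ∧ ∃ s ∈ (ts.get j).leaves, v ∈ s
    · exact ⟨_, .refl, Set.mem_iUnion.2 ⟨i, hv, ⟨s, hst, hvs⟩, hex⟩⟩
    · obtain ⟨M, hM, hvM⟩ := ih _ ht (hN.trans (.qnode ht .refl)) (fun s' hs' hvs' => by
        obtain ⟨t', ht', hst'⟩ := PQTree.mem_leaves_qnode.1 (hv s' hs' hvs')
        obtain ⟨j, rfl⟩ := List.get_of_mem ht'
        rcases eq_or_ne j i with rfl | h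
        · exact hst'
        · exact (hex ⟨j, h, s', hst', hvs'⟩).elim) ⟨s, hst, hvs⟩
      exact ⟨M, .qnode ht hM, hvM⟩

/-! ### Positions of the maximal cliques -/

theorem exists_isMaxClique {V : Type u} [Finite V] {G : SimpleGraph V} {s : Set V}
    (hs : G.IsClique s) : ∃ t, IsMaxClique G t ∧ s ⊆ t := by
  obtain ⟨t, hst, ht⟩ := (Set.toFinite {s : Set V | G.IsClique s}).exists_le_maximal hs
  exact ⟨t, ht, hst⟩

/-- The members of the list `l` that contain the vertex `v` are those at the positions from `ℓ v`
to `r v`, and there is at least one. -/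
def IsPositions {V : Type u} (l : List (Set V)) (ℓ r : V → ℕ) : Prop :=
  ∀ v, ℓ v ≤ r v ∧ r v < l.length ∧ ∀ i (hi : i < l.length), v ∈ l[i] ↔ ℓ v ≤ i ∧ i ≤ r v

theorem IsConsecutiveOrdering.exists_positions {V : Type u} [Finite V] {G : SimpleGraph V}
    {l : List (Set V)} (h : IsConsecutiveOrdering G l) :
    ∃ ℓ r : V → ℕ, IsPositions l ℓ r := by
  have key : ∀ v, ∃ a b : ℕ, a ≤ b ∧ b < l.length ∧
      ∀ i (hi : i < l.length), v ∈ l[i] ↔ a ≤ i ∧ i ≤ b := by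
    intro v
    obtain ⟨s, hs, hvs⟩ := exists_isMaxClique (G := G) (SimpleGraph.isClique_singleton v)
    obtain ⟨⟨j, hj⟩, rfl⟩ := List.get_of_mem ((h.mem_iff s).2 hs)
    let I : Set (Fin l.length) := {i | v ∈ l.get i}
    have hI : I.Nonempty := ⟨⟨j, hj⟩, hvs rfl⟩
    obtain ⟨a, ha, ha'⟩ := Set.exists_min_image I id I.toFinite hI
    obtain ⟨b, hb, hb'⟩ := Set.exists_max_image I id I.toFinite hI
    refine ⟨a, b, ha' b hb, b.2, fun i hi => ⟨fun hv => ⟨ha' ⟨i, hi⟩ hv, hb' ⟨i, hi⟩ hv⟩, ?_⟩⟩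
    rintro ⟨h1, h2⟩
    rcases h1.eq_or_lt with rfl | h1
    · exact ha
    rcases h2.eq_or_lt with rfl | h2
    · exact hb
    exact h.consecutive v a ⟨i, hi⟩ b h1 h2 ha hb
  choose ℓ r hr using key
  exact ⟨ℓ, r, hr⟩

theorem adj_iff_positions {V : Type u} [Finite V] {G : SimpleGraph V} {l : List (Set V)}
    {ℓ r : V → ℕ} (h : IsConsecutiveOrdering G l) (hp : IsPositions l ℓ r) {u v : V} (huv : u ≠ v) :
    G.Adj u v ↔ ℓ u ≤ r v ∧ ℓ v ≤ r u := by
  constructor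
  · intro hadj
    obtain ⟨s, hs, huvs⟩ := exists_isMaxClique (G := G) (s := {u, v})
      (SimpleGraph.isClique_pair.2 fun _ => hadj)
    obtain ⟨i, hi, rfl⟩ := List.mem_iff_getElem.1 ((h.mem_iff s).2 hs)
    have h1 := ((hp u).2.2 i hi).1 (huvs (by simp))
    have h2 := ((hp v).2.2 i hi).1 (huvs (by simp))
    omega
  · intro hlr
    have hu := hp u
    have hv := hp v
    have hi : max (ℓ u) (ℓ v) < l.length := by omega
    exact ((h.mem_iff _).1 (List.getElem_mem hi)).1 ((hu.2.2 _ hi).2 (by omega))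
      ((hv.2.2 _ hi).2 (by omega)) huv

theorem exists_mem_notMem {V : Type u} {G : SimpleGraph V} {l : List (Set V)}
    (h : IsConsecutiveOrdering G l) {i j : ℕ} (hi : i < l.length) (hj : j < l.length)
    (hij : i ≠ j) : ∃ v ∈ l[i], v ∉ l[j] := by
  by_contra! hcon
  have hi' := (h.mem_iff _).1 (List.getElem_mem hi)
  have hj' := (h.mem_iff _).1 (List.getElem_mem hj)
  exact hij ((h.nodup.getElem_inj_iff).1 (hi'.eq_of_subset hj'.1 hcon))

/-- The reversal of the positions from `i` to `j`. -/
def reflect (i j p : ℕ) : ℕ := if i ≤ p ∧ p ≤ j then i + j - p else p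

/-- If every vertex that occurs at positions from `i` to `j` occurs only there or at all of them,
then these positions can be reversed. -/
theorem isConsecutiveOrdering_reflect {V : Type u} {G : SimpleGraph V} {l : List (Set V)}
    {ℓ r : V → ℕ} (h : IsConsecutiveOrdering G l) (hp : IsPositions l ℓ r)
    {i j : ℕ} (hj : j < l.length)
    (hmod : ∀ v, ℓ v ≤ j → i ≤ r v → (i ≤ ℓ v ∧ r v ≤ j) ∨ (ℓ v ≤ i ∧ j ≤ r v)) :
    ∃ l', IsConsecutiveOrdering G l' ∧
      ∀ p (hp : p < l'.length), ∃ hq : reflect i j p < l.length, l'[p] = l[reflect i j p] := by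
  have hlt : ∀ p, p < l.length → reflect i j p < l.length := by
    intro p hp
    unfold reflect
    split_ifs <;> omega
  have hinv : ∀ p, reflect i j (reflect i j p) = p := by
    intro p
    unfold reflect
    split_ifs <;> omega
  refine ⟨List.ofFn fun p : Fin l.length => l[reflect i j p]'(hlt p p.2), ⟨?_, fun s => ?_, ?_⟩,
    fun p hp => ⟨hlt p (by simpa using hp), by simp⟩⟩
  · rw [List.nodup_ofFn]
    intro p q hpq
    have := (h.nodup.getElem_inj_iff).1 hpq
    exact Fin.ext (by rw [← hinv p, this, hinv])
  · rw [← h.mem_iff, List.mem_ofFn, List.mem_iff_getElem]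
    constructor
    · rintro ⟨p, rfl⟩
      exact ⟨_, _, rfl⟩
    · rintro ⟨p, hp, rfl⟩
      exact ⟨⟨_, hlt p hp⟩, by simp [hinv]⟩
  · intro v p₁ p₂ p₃ h12 h23 h1 h3
    simp only [List.get_eq_getElem, List.getElem_ofFn] at h1 h3 ⊢
    rw [(hp v).2.2] at h1 h3 ⊢
    have := hmod v
    have := (hp v).1
    have h12' : (p₁ : ℕ) < p₂ := h12
    have h23' : (p₂ : ℕ) < p₃ := h23
    generalize (p₁ : ℕ) = q₁ at *
    generalize (p₂ : ℕ) = q₂ at *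
    generalize (p₃ : ℕ) = q₃ at *
    unfold reflect at *
    split_ifs at * <;> omega

theorem exists_getElem_of_triple_sublist {α : Type*} {l : List α} {a b c : α}
    (h : [a, b, c].Sublist l) : ∃ i j k, ∃ (_ : i < j) (_ : j < k) (hk : k < l.length),
      l[i] = a ∧ l[j] = b ∧ l[k] = c := by
  obtain ⟨f, hf⟩ := List.sublist_iff_exists_fin_orderEmbedding_get_eq.1 h
  exact ⟨f ⟨0, by simp⟩, f ⟨1, by simp⟩, f ⟨2, by simp⟩, f.lt_iff_lt.2 (by simp),
    f.lt_iff_lt.2 (by simp), (f _).2, (hf ⟨0, by simp⟩).symm, (hf ⟨1, by simp⟩).symm,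
    (hf ⟨2, by simp⟩).symm⟩

/-! ### The window of a Q-node -/

theorem PartialRep.Between.not_adj {V : Type u} {G : SimpleGraph V} {R : PartialRep G} {x y z : V}
    (h : R.Between x y z) (hx : x ∈ R.dom) (hy : y ∈ R.dom) (hz : z ∈ R.dom) :
    (x ≠ z ∧ ¬ G.Adj x z) ∧ z ≠ y ∧ ¬ G.Adj z y := by
  have hx' := R.left_le_right x hx
  have hy' := R.left_le_right y hy
  have hz' := R.left_le_right z hz
  have key : ∀ v ∈ R.dom, ∀ w ∈ R.dom, R.right v < R.left w ∨ R.right w < R.left v →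
      v ≠ w ∧ ¬ G.Adj v w := by
    intro v hv w hw hvw
    have hne : v ≠ w := by
      rintro rfl
      have := R.left_le_right v hv
      rcases hvw with h | h <;> linarith
    refine ⟨hne, fun hadj => ?_⟩
    obtain ⟨p, hp, hp'⟩ := (R.adj_iff v hv w hw hne).1 hadj
    have := hp.1
    have := hp.2
    have := hp'.1
    have := hp'.2
    rcases hvw with h | h <;> linarith
  rcases h with h | h
  · exact ⟨key x hx z hz (.inl (by linarith)), key z hz y hy (.inr h.2)⟩
  · exact ⟨key x hx z hz (.inr (by linarith)), key z hz y hy (.inl h.1)⟩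

/-- If `x`, `z`, `y` occur in this order in cliques below three children of a Q-node, then the
positions from the end of `x` to the last position below the Q-node form a window. Reversing a range
of them that contains the intervals of `y` and `z` would move the clique `c` between `a` and
`b`. -/
theorem exists_isWindow {V : Type u} [Finite V] {G : SimpleGraph V} {T : PQTree (Set V)}
    (hT : IsPQTreeOf T G) {ts : List (PQTree (Set V))} (hQ : PQTree.IsSubtree (.qnode ts) T)
    {α β γ : Fin ts.length} (hαβ : α < β) (hβγ : β < γ) {a b c : Set V}
    (ha : a ∈ (ts.get α).leaves) (hb : b ∈ (ts.get β).leaves) (hc : c ∈ (ts.get γ).leaves)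
    {x y z : V} (hx : x ∈ a) (hy : y ∈ c) (hz : z ∈ b) (hxz : x ≠ z ∧ ¬ G.Adj x z)
    (hzy : z ≠ y ∧ ¬ G.Adj z y) :
    ∃ (ℓ r : V → ℤ) (A : Set V) (L E : ℤ), A ⊆ subtreeVerts G (.qnode ts) ∧
      IsWindow G ℓ r A L E x y z := by
  have hclique : ∀ {s}, s ∈ (PQTree.qnode ts).leaves → IsMaxClique G s := by
    intro s hs
    obtain ⟨l, hl⟩ := T.exists_frontier
    exact (((hT.frontier_iff l).1 hl).mem_iff s).1 (hl.mem_iff.2 (hQ.trans hs))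
  have haQ : a ∈ (PQTree.qnode ts).leaves :=
    PQTree.mem_leaves_qnode.2 ⟨_, ts.get_mem α, ha⟩
  have hbQ : b ∈ (PQTree.qnode ts).leaves :=
    PQTree.mem_leaves_qnode.2 ⟨_, ts.get_mem β, hb⟩
  have hcQ : c ∈ (PQTree.qnode ts).leaves :=
    PQTree.mem_leaves_qnode.2 ⟨_, ts.get_mem γ, hc⟩
  have hxb : x ∉ b := fun h => hxz.2 ((hclique hbQ).1 h hz hxz.1)
  have hyb : y ∉ b := fun h => hzy.2 ((hclique hbQ).1 hz h hzy.1)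
  have hzc : z ∉ c := fun h => hzy.2 ((hclique hcQ).1 h hy hzy.1)
  obtain ⟨l₁, l₂, hl⟩ := hQ.exists_frontier_append
  obtain ⟨ls, hls⟩ := PQTree.exists_frontiers ts
  obtain ⟨i, j, k, hij, hjk, hk, hi', hj', hk'⟩ := exists_getElem_of_triple_sublist
    (PQTree.triple_sublist_flatten hls (PQTree.triple_get_sublist hαβ hβγ) ha hb hc)
  have hQl : (PQTree.qnode ts).Frontier ls.flatten := .qnode hls
  generalize ls.flatten = lq at *
  have hord := (hT.frontier_iff _).1 (hl _ hQl)
  obtain ⟨l, hleq⟩ : ∃ l, l = l₁ ++ lq ++ l₂ := ⟨_, rfl⟩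
  rw [← hleq] at hord
  obtain ⟨s₀, hs₀⟩ : ∃ n, n = l₁.length := ⟨_, rfl⟩
  obtain ⟨e₀, he₀⟩ : ∃ n, n + 1 = l₁.length + lq.length :=
    ⟨l₁.length + lq.length - 1, by omega⟩
  have hlen : l.length = l₁.length + lq.length + l₂.length := by simp [hleq, Nat.add_assoc]
  have hin : ∀ p (hp : p < l.length), s₀ ≤ p → p ≤ e₀ → l[p] ∈ (PQTree.qnode ts).leaves := by
    intro p hp h1 h2
    rw [← hQl.mem_iff]
    subst hleq
    rw [List.getElem_append_left (by simp; omega), List.getElem_append_right (by omega)]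
    exact List.getElem_mem _
  have hout : ∀ p (hp : p < l.length), p < s₀ ∨ e₀ < p → l[p] ∈ l₁ ∨ l[p] ∈ l₂ := by
    intro p hp h1
    subst hleq
    rcases h1 with h1 | h1
    · left
      rw [List.getElem_append_left (by simp; omega), List.getElem_append_left (by omega)]
      exact List.getElem_mem _
    · right
      rw [List.getElem_append_right (by simp; omega)]
      exact List.getElem_mem _
  have hsub : ∀ p (hp : p < lq.length), ∃ hp' : s₀ + p < l.length, l[s₀ + p] = lq[p] := by
    intro p hp
    refine ⟨by omega, ?_⟩
    subst hleq hs₀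
    rw [List.getElem_append_left (by simp; omega), List.getElem_append_right (by omega)]
    simp
  obtain ⟨hi, hli⟩ := hsub i (by omega)
  obtain ⟨hj, hlj⟩ := hsub j (by omega)
  obtain ⟨hk, hlk⟩ := hsub k (by omega)
  rw [hi'] at hli
  rw [hj'] at hlj
  rw [hk'] at hlk
  obtain ⟨ℓ, r, hp⟩ := hord.exists_positions
  have hmem : ∀ v p (h : p < l.length), v ∈ l[p] ↔ ℓ v ≤ p ∧ p ≤ r v := fun v => (hp v).2.2
  have hcov : ∀ v p q (hp : p < l.length) (hq : q < l.length), s₀ ≤ p → p ≤ e₀ →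
      v ∈ l[p] → q < s₀ ∨ e₀ < q → v ∈ l[q] → ∀ s ∈ (PQTree.qnode ts).leaves, v ∈ s :=
    fun v p q hp hq h1 h2 hv h3 hv' s hs =>
      mem_of_mem_outside hT hl (hout q hq h3) hv' (hin p hp h1 h2) hv hs
  -- A vertex that misses some clique below the Q-node but lies in another one lies below it.
  have hinside : ∀ v p (hp : p < l.length), s₀ ≤ p → p ≤ e₀ → v ∈ l[p] →
      (∃ s ∈ (PQTree.qnode ts).leaves, v ∉ s) → s₀ ≤ ℓ v ∧ r v ≤ e₀ := by
    rintro v p hlp h1 h2 hv ⟨s, hs, hvs⟩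
    have hv1 := (hp v).1
    have hv2 := (hp v).2.1
    constructor <;> by_contra hcon
    · exact hvs (hcov v p (ℓ v) hlp (by omega) h1 h2 hv (.inl (by omega))
        ((hmem _ _ _).2 ⟨le_rfl, hv1⟩) s hs)
    · exact hvs (hcov v p (r v) hlp (by omega) h1 h2 hv (.inr (by omega))
        ((hmem _ _ _).2 ⟨hv1, le_rfl⟩) s hs)
  have hxa := (hmem x _ hi).1 (hli ▸ hx)
  have hzb := (hmem z _ hj).1 (hlj ▸ hz)
  have hyc := (hmem y _ hk).1 (hlk ▸ hy)
  have hxQ := hinside x _ hi (by omega) (by omega) (hli ▸ hx) ⟨b, hbQ, hxb⟩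
  have hzQ := hinside z _ hj (by omega) (by omega) (hlj ▸ hz) ⟨c, hcQ, hzc⟩
  have hyQ := hinside y _ hk (by omega) (by omega) (hlk ▸ hy) ⟨b, hbQ, hyb⟩
  have hxz' : r x < ℓ z := by
    have := mt (adj_iff_positions hord hp hxz.1).2 hxz.2
    omega
  have hzy' : r z < ℓ y := by
    have := mt (adj_iff_positions hord hp hzy.1).2 hzy.2
    omega
  have he₀l : e₀ < l.length := by omega
  let A : Set V := {v | s₀ ≤ ℓ v ∧ r v ≤ e₀ ∧ (r x + 1 ≤ r v ∨ v = x)}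
  -- For `starts` and `ends`: of two consecutive maximal cliques, neither contains the other.
  refine ⟨fun v => ℓ v, fun v => r v, A, r x + 1, e₀, fun v hv => ?_, fun v => ?_,
    fun u v huv => ?_, fun p h1 h2 => ?_, fun p h1 h2 => ?_, ?_, ⟨hxQ.1, hxQ.2, .inr rfl⟩,
    ⟨hyQ.1, hyQ.2, .inl (by omega)⟩, ⟨hzQ.1, hzQ.2, .inl (by omega)⟩, fun v hv h1 h2 => ?_, rfl,
    fun v hv hne => ?_, fun v hv => ?_, by omega, by omega⟩
  · refine mem_subtreeVerts hT hQ (fun s hs hvs => ?_) ⟨l[ℓ v]'(by have := hp v; omega),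
      hin _ _ hv.1 (by have := hv.2.1; have := hp v; omega), (hmem _ _ _).2 ⟨le_rfl, (hp v).1⟩⟩
    obtain ⟨p, hlp, rfl⟩ := List.mem_iff_getElem.1 ((hord.mem_iff s).2 hs)
    have h1 := (hmem _ _ _).1 hvs
    have h2 := hv.1
    have h3 := hv.2.1
    exact hin p hlp (by omega) (by omega)
  · exact_mod_cast (hp v).1
  · rw [adj_iff_positions hord hp huv]
    omega
  · lift p to ℕ using by omega
    obtain ⟨v, hv, hv'⟩ := exists_mem_notMem hord (i := p + 1) (j := p) (by omega) (by omega)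
      (by omega)
    rw [hmem] at hv hv'
    exact ⟨v, by omega⟩
  · lift p to ℕ using by omega
    obtain ⟨v, hv, hv'⟩ := exists_mem_notMem hord (i := p) (j := p + 1) (by omega) (by omega)
      (by omega)
    rw [hmem] at hv hv'
    exact ⟨v, by omega⟩
  · intro m n h1 h2 h3 h4 h5 h6 hmod
    lift m to ℕ using by omega
    lift n to ℕ using by omega
    obtain ⟨l', hord', hl'⟩ := isConsecutiveOrdering_reflect hord hp (i := m) (j := n) (by omega)
      (fun v h7 h8 => by have := hmod v (by omega) (by omega); omega)
    -- A clique of `l'` at position `p` is at the reflected position in `l`.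
    have hpos : ∀ p q (hlp : p < l'.length) (hlq : q < l.length), l'[p] = l[q] →
        reflect m n p = q := by
      intro p q hlp hlq h
      obtain ⟨h', e⟩ := hl' p hlp
      exact (hord.nodup.getElem_inj_iff).1 (e.symm.trans h)
    rcases hQ.triple_sublist_frontier hαβ hβγ ha hb hc ((hT.frontier_iff l').2 hord') with h | h
    · obtain ⟨p₁, p₂, p₃, h12, h23, h3', e₁, e₂, e₃⟩ := exists_getElem_of_triple_sublist h
      have q₁ := hpos _ _ _ _ (e₁.trans hli.symm)
      have q₂ := hpos _ _ _ _ (e₂.trans hlj.symm)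
      have q₃ := hpos _ _ _ _ (e₃.trans hlk.symm)
      unfold reflect at q₁ q₂ q₃
      split_ifs at q₁ q₂ q₃ <;> omega
    · obtain ⟨p₁, p₂, p₃, h12, h23, h3', e₁, e₂, e₃⟩ := exists_getElem_of_triple_sublist h
      have q₁ := hpos _ _ _ _ (e₁.trans hlk.symm)
      have q₂ := hpos _ _ _ _ (e₂.trans hlj.symm)
      have q₃ := hpos _ _ _ _ (e₃.trans hli.symm)
      unfold reflect at q₁ q₂ q₃
      split_ifs at q₁ q₂ q₃ <;> omega
  · have hv1 := hp v
    have hvp : v ∈ l[max (ℓ v) (r x + 1)]'(by omega) := (hmem _ _ _).2 (by omega)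
    have hall : ∀ s ∈ (PQTree.qnode ts).leaves, v ∈ s := by
      by_contra! hcon
      have := hinside v _ _ (by omega) (by omega) hvp hcon
      exact hv ⟨this.1, this.2, .inl (by omega)⟩
    have h3 := (hmem v (r x + 1) (by omega)).1 (hall _ (hin _ _ (by omega) (by omega)))
    have h4 := (hmem v e₀ he₀l).1 (hall _ (hin _ _ (by omega) (by omega)))
    omega
  · have := hv.2.2.resolve_right hne
    omega
  · have := hv.2.1
    omega

end IntervalObstruction

theorem mainTheorem2 {V : Type u} [Finite V] (G : SimpleGraph V)
    (R : IntervalObstruction.PartialRep G)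
    (T : IntervalObstruction.PQTree (Set V)) (hT : IntervalObstruction.IsPQTreeOf T G)
    (ts : List (IntervalObstruction.PQTree (Set V)))
    (hQ : IntervalObstruction.PQTree.IsSubtree (IntervalObstruction.PQTree.qnode ts) T)
    (α β γ : Fin ts.length) (hαβ : α < β) (hβγ : β < γ)
    (a b c : Set V) (ha : a ∈ (ts.get α).leaves) (hb : b ∈ (ts.get β).leaves)
    (hc : c ∈ (ts.get γ).leaves)
    (x y z : V) (hx : x ∈ R.preDrawn a) (hy : y ∈ R.preDrawn c) (hz : z ∈ R.preDrawn b)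
    (hxyz : R.Between x y z) :
    ∃ (k : ℕ) (W : Type u) (H : SimpleGraph W) (RH : IntervalObstruction.PartialRep H)
      (xk yk zk : W)
      (f : H ↪g G.induce
        (IntervalObstruction.subtreeVerts G (IntervalObstruction.PQTree.qnode ts))),
      1 ≤ k ∧
      IntervalObstruction.IsFATObstruction k H RH xk yk zk ∧
      RH.IsContainment
        ((R.restrict {x, y, z}).induce
          (IntervalObstruction.subtreeVerts G (IntervalObstruction.PQTree.qnode ts))) f ∧
      (f xk : V) = x ∧ (f yk : V) = y ∧ (f zk : V) = z := by
  obtain ⟨hxz, hzy⟩ := hxyz.not_adj hx.2 hy.2 hz.2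
  obtain ⟨ℓ, r, A, L, E, hA, hwin⟩ := IntervalObstruction.exists_isWindow hT hQ hαβ hβγ ha hb hc
    hx.1 hy.1 hz.1 hxz hzy
  obtain ⟨k, S, hk, hSA, hS⟩ := hwin.exists_isFATGraphOn
  obtain ⟨hxS, hyS, hzS⟩ := hS.mem
  refine ⟨k, S, G.induce S, (R.restrict {x, y, z}).induce S, ⟨x, hxS⟩, ⟨y, hyS⟩, ⟨z, hzS⟩,
    G.induceHomOfLE (hSA.trans hA), hk, ⟨?_, ?_, hxyz⟩, ?_, rfl, rfl, rfl⟩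
  · simpa using hS.induce (Set.Subset.refl S)
  · ext ⟨v, hv⟩
    simp only [IntervalObstruction.PartialRep.induce, IntervalObstruction.PartialRep.restrict,
      Set.mem_ofPred_eq, Set.mem_inter_iff, Set.mem_insert_iff, Set.mem_singleton_iff,
      Subtype.mk.injEq]
    refine ⟨fun h => h.2, fun h => ⟨?_, h⟩⟩
    rcases h with rfl | rfl | rfl
    exacts [hx.2, hy.2, hz.2]
  · exact ⟨fun v hv => hv, fun _ _ _ _ => Iff.rfl, fun _ _ _ _ => Iff.rfl,
      fun _ _ _ _ => Iff.rfl, fun _ _ _ _ => Iff.rfl⟩
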